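/- Let $\mathcal H$ be a separable infinite-dimensional complex Hilbert space with orthonormal (Fock) basis $(|n\rangle)_{n\ge 0}$ and number operator $a^\dagger a|n\rangle=n|n\rangle$. For $\gamma>0$ let $$\mathcal N_\gamma(\rho)=\int_{-\infty}^{\infty}\frac{e^{-\theta^2/(2\gamma)}}{\sqrt{2\pi\gamma}}\,e^{-ia^\dagger a\theta}\rho\,e^{ia^\dagger a\theta}\,d\theta$$ be the bosonic dephasing channel with dephasing rate $\gamma$, acting on trace-class operators, and let $$p_\gamma(\theta)=\frac{1}{\sqrt{2\pi\gamma}}\sum_{k\in\mathbb Z}e^{-(\theta+2\pi k)^2/(2\gamma)}$$ be the wrapped normal density. Let $\gamma_1,\gamma_2>0$ and $q_1,q_2\ge 0$ with $q_1+q_2=1$. Then, without any input energy constraint, $$\sup_{\rho}\bigl\|q_1\mathcal N_{\gamma_1}(\rho)-q_2\mathcal N_{\gamma_2}(\rho)\bigr\|_1=\int_{-\pi}^{\pi}\bigl|q_1p_{\gamma_1}(\theta)-q_2p_{\gamma_2}(\theta)\bigr|\,d\theta ,$$ where the supremum is over all pure states $\rho=|\psi\rangle\langle\psi|$, $\|\psi\|=1$,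 and $\|A\|_1=\operatorname{Tr}\sqrt{A^\dagger A}$; in particular the function $q_1p_{\gamma_1}-q_2p_{\gamma_2}$ is integrable on $[-\pi,\pi]$. Consequently the optimal single-shot error probability for discriminating the channels $\mathcal N_{\gamma_1},\mathcal N_{\gamma_2}$, occurring with prior probabilities $q_1,q_2$, is $$\inf_{\rho,(\Pi_1,\Pi_2)}\Bigl[q_1\operatorname{Tr}\bigl(\Pi_2\mathcal N_{\gamma_1}(\rho)\bigr)+q_2\operatorname{Tr}\bigl(\Pi_1\mathcal N_{\gamma_2}(\rho)\bigr)\Bigr]=\frac12\Bigl(1-\int_{-\pi}^{\pi}\bigl|q_1p_{\gamma_1}(\theta)-q_2p_{\gamma_2}(\theta)\bigr|\,d\theta\Bigr),$$ where the infimum is over all density operators $\rho$ on $\mathcal H$ and all two-outcome POVMs $(\Pi_1,\Pi_2)$, i.e. bounded operators $\Pi_1,\Pi_2\ge 0$ with $\Pi_1+\Pi_2=I$. -/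

import Mathlib

open scoped NNReal ENNReal InnerProductSpace

noncomputable section

namespace BosonicDephasing

variable {H : Type*} [NormedAddCommGroup H] [InnerProductSpace ℂ H]

/-! Throughout, `b : HilbertBasis ℕ ℂ H` is the Fock basis `|0⟩, |1⟩, …` of the (separable,
infinite-dimensional) Hilbert space `H` of one bosonic mode, that is the orthonormal eigenbasis
`a†a |n⟩ = n |n⟩` of the number operator. -/

theorem phased_orthonormal (b : HilbertBasis ℕ ℂ H) (θ : ℝ) :
    Orthonormal ℂ (fun n : ℕ => Complex.exp (-(Complex.I * n * θ)) • b n) := by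
  have hn : ∀ n : ℕ, ‖Complex.exp (-(Complex.I * n * θ))‖ = 1 := fun n => by
    rw [show -(Complex.I * n * θ) = ((-(n * θ) : ℝ) : ℂ) * Complex.I by push_cast; ring]
    exact Complex.norm_exp_ofReal_mul_I _
  refine ⟨fun n => ?_, fun m n hmn => ?_⟩
  · rw [norm_smul, hn, b.orthonormal.1 n, mul_one]
  · simp only [inner_smul_left, inner_smul_right]
    rw [b.orthonormal.2 hmn, mul_zero, mul_zero]

theorem phased_dense (b : HilbertBasis ℕ ℂ H) (θ : ℝ) :
    ⊤ ≤ (Submodule.span ℂ (Set.range fun n : ℕ =>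
      Complex.exp (-(Complex.I * n * θ)) • b n)).topologicalClosure := by
  rw [← b.dense_span]
  refine Submodule.topologicalClosure_mono (Submodule.span_le.2 ?_)
  rintro _ ⟨n, rfl⟩
  have h := Submodule.smul_mem (Submodule.span ℂ (Set.range fun n : ℕ =>
    Complex.exp (-(Complex.I * n * θ)) • b n)) (Complex.exp (Complex.I * n * θ))
    (Submodule.subset_span ⟨n, rfl⟩)
  rw [smul_smul, ← Complex.exp_add, add_neg_cancel, Complex.exp_zero, one_smul] at h
  exact h

variable [CompleteSpace H]

/-- The Fock basis with the `n`-th vector multiplied by the phase `e^{-i n θ}`. -/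
def phasedBasis (b : HilbertBasis ℕ ℂ H) (θ : ℝ) : HilbertBasis ℕ ℂ H :=
  HilbertBasis.mk (phased_orthonormal b θ) (phased_dense b θ)

/-- The phase rotation `e^{-i a†a θ}`: the unitary operator with `|n⟩ ↦ e^{-i n θ} |n⟩`. -/
def phase (b : HilbertBasis ℕ ℂ H) (θ : ℝ) : H ≃ₗᵢ[ℂ] H :=
  b.repr.trans (phasedBasis b θ).repr.symm

theorem phase_apply_fock (b : HilbertBasis ℕ ℂ H) (θ : ℝ) (n : ℕ) :
    phase b θ (b n) = Complex.exp (-(Complex.I * n * θ)) • b n := by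
  rw [phase, LinearIsometryEquiv.trans_apply, HilbertBasis.repr_self,
    HilbertBasis.repr_symm_single, phasedBasis, HilbertBasis.coe_mk]

/-- `e^{-i a†a θ}` as a bounded operator on `H`. -/
def phaseOp (b : HilbertBasis ℕ ℂ H) (θ : ℝ) : H →L[ℂ] H :=
  ((phase b θ).toContinuousLinearEquiv : H →L[ℂ] H)

/-- The bosonic dephasing channel with dephasing rate `γ ≥ 0`:
`𝒩_γ(ρ) = ∫ e^{-i a†a θ} ρ e^{i a†a θ} dg(θ)`, where `g` is the normal distribution on the real line
with mean `0` and variance `γ`. For a trace-class `ρ` the integrand is bounded and norm continuous,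
so that the integral is an honest Bochner integral. -/
def dephasing (b : HilbertBasis ℕ ℂ H) (γ : ℝ≥0) (ρ : H →L[ℂ] H) : H →L[ℂ] H :=
  ∫ θ : ℝ, phaseOp b θ * ρ * star (phaseOp b θ) ∂(ProbabilityTheory.gaussianReal 0 γ)

/-- The wrapped normal density `p_γ(θ) = (2πγ)^{-1/2} ∑_{k ∈ ℤ} e^{-(θ + 2πk)²/(2γ)}`. -/
def wrappedNormal (γ : ℝ≥0) (θ : ℝ) : ℝ :=
  1 / √(2 * Real.pi * γ) * ∑' k : ℤ, Real.exp (-(1 / (2 * γ)) * (θ + 2 * Real.pi * k) ^ 2)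

/-- The trace norm `‖A‖₁ = Tr √(A†A)`, with values in `[0, ∞]`; it is finite exactly when `A` is
trace class. (The trace of a positive operator does not depend on the orthonormal basis.) -/
def traceNorm (b : HilbertBasis ℕ ℂ H) (A : H →L[ℂ] H) : ℝ≥0∞ :=
  ∑' n, ENNReal.ofReal (⟪b n, CFC.sqrt (star A * A) (b n)⟫_ℂ).re

/-- The trace `Tr A = ∑ₙ ⟨n|A|n⟩` of a trace-class operator. -/
def trace (b : HilbertBasis ℕ ℂ H) (A : H →L[ℂ] H) : ℂ :=
  ∑' n, ⟪b n, A (b n)⟫_ℂ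

/-- Density operators: positive operators of trace one. -/
def IsDensityOperator (b : HilbertBasis ℕ ℂ H) (ρ : H →L[ℂ] H) : Prop :=
  ρ.IsPositive ∧ HasSum (fun n => ⟪b n, ρ (b n)⟫_ℂ) 1

/-- Pure states: the operators `|ψ⟩⟨ψ|` with `ψ` a unit vector. -/
def IsPureState (ρ : H →L[ℂ] H) : Prop :=
  ∃ ψ : H, ‖ψ‖ = 1 ∧ ρ = InnerProductSpace.rankOne ℂ ψ ψ

/-- `Δ(ρ) = q₁ 𝒩_{γ₁}(ρ) - q₂ 𝒩_{γ₂}(ρ)`. -/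
def discrepancy (b : HilbertBasis ℕ ℂ H) (γ₁ γ₂ : ℝ≥0) (q₁ q₂ : ℝ) (ρ : H →L[ℂ] H) : H →L[ℂ] H :=
  (q₁ : ℂ) • dephasing b γ₁ ρ - (q₂ : ℂ) • dephasing b γ₂ ρ

/-- `(Π₁, Π₂)` is a two-outcome POVM; outcome `i` stands for the guess "the channel is `i`". -/
def IsBinaryPOVM (P₁ P₂ : H →L[ℂ] H) : Prop :=
  P₁.IsPositive ∧ P₂.IsPositive ∧ P₁ + P₂ = 1

/-- The probability `q₁ Tr(Π₂ 𝒩_{γ₁}(ρ)) + q₂ Tr(Π₁ 𝒩_{γ₂}(ρ))` of a wrong guess, when the channel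
is `𝒩_{γᵢ}` with prior probability `qᵢ`, the input state is `ρ` and the measurement of the output
is `(Π₁, Π₂)`. -/
def errorProbability (b : HilbertBasis ℕ ℂ H) (γ₁ γ₂ : ℝ≥0) (q₁ q₂ : ℝ)
    (ρ P₁ P₂ : H →L[ℂ] H) : ℝ :=
  q₁ * (trace b (P₂ * dephasing b γ₁ ρ)).re + q₂ * (trace b (P₁ * dephasing b γ₂ ρ)).re

end BosonicDephasing

end

open scoped NNReal ENNReal InnerProductSpace

noncomputable section

namespace BosonicDephasing

/-! In the Fock basis $\mathcal N_\gamma$ multiplies the $(n,m)$ entry by $e^{-\gamma(m-n)^2/2}$.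
This number is a Fourier coefficient both of the Gaussian on the line and of its wrapping on the
circle, so with $f=q_1p_{\gamma_1}-q_2p_{\gamma_2}$ the discrepancy is $\int_{-\pi}^{\pi}
f(\theta)\,U_\theta\rho U_\theta^*\,d\theta$ (`discrepancy_eq_twirl`).

Upper bound: every $U_\theta\rho U_\theta^*$ is a density operator, so testing against a contraction
$T$ gives at most $\int|f|$ (`norm_sum_inner_mul_twirl_le`). An approximate sign of the discrepancy
turns this into a trace norm bound.

Attainment: take the uniform superposition of $|0\rangle,\dots,|N-1\rangle$ and as test operator the
truncated Toeplitz matrix with symbol $s=\operatorname{sgn} f$. It is a contraction because $|s|\le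
1$. The trace of its product with the discrepancy is a Cesàro mean of the Fourier pairing of $s$
with $f$, hence tends to $\int sf=\int|f|$ (`exists_tendsto_trace`).

With $T=\Pi_1-\Pi_2$ the error probability is $(1-\operatorname{Tr}T\Delta(\rho))/2$
(`errorProbability_eq`), so the same two bounds settle the discrimination problem. -/

open MeasureTheory Filter Topology

/-! ### Fourier series of the wrapped normal density -/

section

/-- The `k`-th Fourier coefficient `e^{-γk²/2}` of the normal distribution of variance `γ`. -/
def gaussCoeff (γ : ℝ≥0) (k : ℤ) : ℝ := Real.exp (-(γ * k ^ 2 / 2))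

theorem gaussCoeff_neg (γ : ℝ≥0) (k : ℤ) : gaussCoeff γ (-k) = gaussCoeff γ k := by
  simp [gaussCoeff]

theorem summable_gaussCoeff {γ : ℝ≥0} (hγ : 0 < γ) : Summable (gaussCoeff γ) := by
  have hγ' : (0 : ℝ) < γ := hγ
  have h : ∀ n : ℕ, gaussCoeff γ n ≤ Real.exp (-(γ / 2)) ^ n := fun n => by
    rw [gaussCoeff, ← Real.exp_nat_mul, Real.exp_le_exp]
    have : (n : ℝ) ≤ (n : ℝ) ^ 2 := by exact_mod_cast Nat.le_self_pow two_ne_zero n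
    push_cast
    nlinarith
  have hs : Summable fun n : ℕ => gaussCoeff γ n :=
    Summable.of_nonneg_of_le (fun n => (Real.exp_pos _).le) h
      (summable_geometric_of_lt_one (Real.exp_pos _).le (by
        rw [Real.exp_lt_one_iff]; linarith))
  refine Summable.of_nat_of_neg hs ?_
  simpa only [gaussCoeff_neg] using hs

theorem norm_exp_int_mul (k : ℤ) (θ : ℝ) : ‖Complex.exp (k * θ * Complex.I)‖ = 1 := by
  rw [show (k : ℂ) * θ * Complex.I = ((k * θ : ℝ) : ℂ) * Complex.I by push_cast; ring]
  exact Complex.norm_exp_ofReal_mul_I _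

/-- Poisson summation, in the form of the theta function identity. -/
theorem wrappedNormal_eq_tsum {γ : ℝ≥0} (hγ : 0 < γ) (θ : ℝ) :
    (wrappedNormal γ θ : ℂ)
      = 1 / (2 * Real.pi) * ∑' k : ℤ, (gaussCoeff γ k : ℂ) * Complex.exp (k * θ * Complex.I) := by
  have hγ' : (0 : ℝ) < γ := hγ
  have hπ := Real.pi_pos
  have hπ' : (Real.pi : ℂ) ≠ 0 := by exact_mod_cast hπ.ne'
  have hγ'' : ((γ : ℝ) : ℂ) ≠ 0 := by exact_mod_cast hγ'.ne'
  have ha : 0 < ((((γ : ℝ) / (2 * Real.pi) : ℝ)) : ℂ).re := by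
    rw [Complex.ofReal_re]; positivity
  -- With $a=\gamma/2\pi$ and $b=i\theta/2\pi$ one side is the Fourier series and the other the sum
  -- of Gaussians, up to $k\mapsto -k$.
  have key := Complex.tsum_exp_neg_quadratic ha (Complex.I * θ / (2 * Real.pi))
  have e1 : ∀ k : ℤ, Complex.exp (-Real.pi * (((γ : ℝ) / (2 * Real.pi) : ℝ) : ℂ) * k ^ 2
      + 2 * Real.pi * (Complex.I * θ / (2 * Real.pi)) * k)
      = (gaussCoeff γ k : ℂ) * Complex.exp (k * θ * Complex.I) := fun k => by
    rw [gaussCoeff, Complex.ofReal_exp, ← Complex.exp_add]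
    congr 1
    push_cast
    field_simp
  have e2 : ∀ k : ℤ, Complex.exp (-Real.pi / (((γ : ℝ) / (2 * Real.pi) : ℝ) : ℂ)
      * (k + Complex.I * (Complex.I * θ / (2 * Real.pi))) ^ 2)
      = (Real.exp (-(1 / (2 * γ)) * (θ + 2 * Real.pi * (-k : ℤ)) ^ 2) : ℂ) := fun k => by
    rw [Complex.ofReal_exp]
    congr 1
    have : Complex.I * (Complex.I * θ / (2 * Real.pi)) = -(θ / (2 * Real.pi)) := by
      rw [← mul_div_assoc, ← mul_assoc, Complex.I_mul_I]; ring
    rw [this]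
    push_cast
    field_simp
    ring
  simp only [e1, e2] at key
  have e0 := (Equiv.neg ℤ).tsum_eq fun k : ℤ =>
    ((Real.exp (-(1 / (2 * γ)) * (θ + 2 * Real.pi * k) ^ 2) : ℝ) : ℂ)
  simp only [Equiv.neg_apply] at e0
  rw [key, e0, wrappedNormal,
    Complex.ofReal_mul, Complex.ofReal_tsum, ← mul_assoc]
  congr 1
  have e3 : ((((γ : ℝ) / (2 * Real.pi) : ℝ)) : ℂ) ^ (1 / 2 : ℂ)
      = ((√((γ : ℝ) / (2 * Real.pi)) : ℝ) : ℂ) := by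
    rw [Real.sqrt_eq_rpow, Complex.ofReal_cpow (by positivity)]
    norm_num
  rw [e3]
  norm_cast
  have e4 : 2 * Real.pi * γ = (2 * Real.pi) ^ 2 * ((γ : ℝ) / (2 * Real.pi)) := by
    field_simp
  rw [e4, Real.sqrt_mul (by positivity), Real.sqrt_sq (by positivity), one_div_mul_one_div]

theorem continuous_wrappedNormal {γ : ℝ≥0} (hγ : 0 < γ) : Continuous (wrappedNormal γ) := by
  have h : Continuous fun θ : ℝ => ((wrappedNormal γ θ : ℝ) : ℂ) := by
    simp only [wrappedNormal_eq_tsum hγ]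
    refine continuous_const.mul (continuous_tsum (fun k => by fun_prop)
      (summable_gaussCoeff hγ) fun k θ => ?_)
    rw [norm_mul, norm_exp_int_mul, mul_one, Complex.norm_real]
    exact (Real.norm_of_nonneg (Real.exp_pos _).le).le
  exact (Complex.continuous_re.comp h).congr fun θ => Complex.ofReal_re _

/-- Absolute summability of the coefficients justifies termwise integration for any integrable `h`.
It is used for `h` an exponential and for `h` the sign of the density difference. -/
theorem hasSum_integral_mul_wrappedNormal {γ : ℝ≥0} (hγ : 0 < γ) {μ : Measure ℝ}
    {h : ℝ → ℂ} (hh : Integrable h μ) :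
    HasSum (fun k : ℤ => (gaussCoeff γ k : ℂ)
        * (1 / (2 * Real.pi) * ∫ θ, h θ * Complex.exp (k * θ * Complex.I) ∂μ))
      (∫ θ, h θ * wrappedNormal γ θ ∂μ) := by
  have hint : ∀ k : ℤ, Integrable (fun θ : ℝ => h θ * Complex.exp (k * θ * Complex.I)) μ :=
    fun k => hh.mul_bdd (c := 1) (by fun_prop)
      (Eventually.of_forall fun θ => (norm_exp_int_mul k θ).le)
  have hn : ∀ k : ℤ, ∫ θ, ‖(gaussCoeff γ k : ℂ) * (1 / (2 * Real.pi)
      * (h θ * Complex.exp (k * θ * Complex.I)))‖ ∂μ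
      = gaussCoeff γ k * (‖(1 / (2 * Real.pi) : ℂ)‖ * ∫ θ, ‖h θ‖ ∂μ) := fun k => by
    simp only [norm_mul, norm_exp_int_mul, mul_one, integral_const_mul, Complex.norm_real]
    rw [Real.norm_of_nonneg (show 0 ≤ gaussCoeff γ k from (Real.exp_pos _).le)]
  have key := hasSum_integral_of_summable_integral_norm (μ := μ)
    (F := fun k : ℤ => fun θ : ℝ => (gaussCoeff γ k : ℂ) * (1 / (2 * Real.pi)
      * (h θ * Complex.exp (k * θ * Complex.I))))
    (fun k => ((hint k).const_mul _).const_mul _)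
    (by simp only [hn]; exact (summable_gaussCoeff hγ).mul_right _)
  simp only [integral_const_mul] at key
  suffices e : ∫ θ, h θ * wrappedNormal γ θ ∂μ = ∫ θ, ∑' k : ℤ, (gaussCoeff γ k : ℂ)
      * (1 / (2 * Real.pi) * (h θ * Complex.exp (k * θ * Complex.I))) ∂μ by rwa [e]
  refine integral_congr_ae (Eventually.of_forall fun θ => ?_)
  simp only [wrappedNormal_eq_tsum hγ]
  rw [← mul_assoc, mul_comm (h θ), mul_assoc, ← tsum_mul_left, ← tsum_mul_left]
  exact tsum_congr fun k => by ring

theorem setIntegral_exp_int_mul (k : ℤ) :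
    ∫ θ in Set.Ioc (-Real.pi) Real.pi, Complex.exp (k * θ * Complex.I)
      = if k = 0 then 2 * (Real.pi : ℂ) else 0 := by
  rw [← intervalIntegral.integral_of_le (by linarith [Real.pi_pos])]
  split_ifs with h
  · simp [h]; ring
  · have hk : (k : ℂ) * Complex.I ≠ 0 := mul_ne_zero (by exact_mod_cast h) Complex.I_ne_zero
    have := integral_exp_mul_complex (a := -Real.pi) (b := Real.pi) hk
    simp only [mul_right_comm _ Complex.I] at this
    rw [this]
    have e : Complex.exp (k * (Real.pi : ℝ) * Complex.I)
        = Complex.exp (k * ((-Real.pi : ℝ) : ℂ) * Complex.I) :=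
      Complex.exp_eq_exp_iff_exists_int.2 ⟨k, by push_cast; ring⟩
    rw [e, sub_self, zero_div]

theorem integral_wrappedNormal_mul_exp {γ : ℝ≥0} (hγ : 0 < γ) (j : ℤ) :
    ∫ θ in Set.Ioc (-Real.pi) Real.pi, (wrappedNormal γ θ : ℂ) * Complex.exp (j * θ * Complex.I)
      = gaussCoeff γ j := by
  have hj : IntegrableOn (fun θ : ℝ => Complex.exp (j * θ * Complex.I))
      (Set.Ioc (-Real.pi) Real.pi) :=
    (Continuous.integrableOn_Icc (by fun_prop)).mono_set Set.Ioc_subset_Icc_self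
  have key := hasSum_integral_mul_wrappedNormal hγ hj
  have e : ∀ k : ℤ, ∫ θ in Set.Ioc (-Real.pi) Real.pi,
      Complex.exp (j * θ * Complex.I) * Complex.exp (k * θ * Complex.I)
      = if k = -j then 2 * (Real.pi : ℂ) else 0 := fun k => by
    have h := setIntegral_exp_int_mul (j + k)
    simp only [Int.cast_add, add_mul, Complex.exp_add] at h
    rw [h]
    exact if_congr (by omega) rfl rfl
  simp only [e] at key
  have hπ' : (Real.pi : ℂ) ≠ 0 := by exact_mod_cast Real.pi_pos.ne'
  have h2 := hasSum_single (f := fun k : ℤ => (gaussCoeff γ k : ℂ)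
    * (1 / (2 * Real.pi) * if k = -j then 2 * (Real.pi : ℂ) else 0)) (-j)
    (fun k hk => by simp [hk])
  have h3 := key.unique h2
  simp only [mul_comm (wrappedNormal γ _ : ℂ)]
  rw [h3, gaussCoeff_neg]
  simp only [if_true]
  field_simp

/-- The characteristic function at integers does not see wrapping: the value agrees with
`integral_wrappedNormal_mul_exp`. -/
theorem integral_gaussianReal_exp (γ : ℝ≥0) (j : ℤ) :
    ∫ θ, Complex.exp (j * θ * Complex.I) ∂(ProbabilityTheory.gaussianReal 0 γ)
      = gaussCoeff γ j := by
  have h := ProbabilityTheory.charFun_gaussianReal (μ := 0) (v := γ) (j : ℝ)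
  rw [charFun_apply_real] at h
  simp only [Complex.ofReal_intCast] at h
  rw [h, gaussCoeff, Complex.ofReal_exp]
  congr 1
  push_cast
  ring

end

/-! ### Traces, Hilbert–Schmidt norms and contractions -/

section

variable {H : Type*} [NormedAddCommGroup H] [InnerProductSpace ℂ H]

theorem hasSum_norm_inner_sq (b : HilbertBasis ℕ ℂ H) (x : H) :
    HasSum (fun n => ‖⟪b n, x⟫_ℂ‖ ^ 2) (‖x‖ ^ 2) := by
  have h := (b.hasSum_inner_mul_inner x x).mapL Complex.reCLM
  have e : Complex.reCLM ⟪x, x⟫_ℂ = ‖x‖ ^ 2 := inner_self_eq_norm_sq (𝕜 := ℂ) x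
  rw [e] at h
  refine h.congr_fun fun n => ?_
  have := inner_mul_symm_re_eq_norm (𝕜 := ℂ) x (b n)
  rw [norm_mul, norm_inner_symm, ← sq] at this
  exact this.symm

theorem tsum_enorm_inner_sq (b : HilbertBasis ℕ ℂ H) (x : H) :
    ∑' n, ‖⟪b n, x⟫_ℂ‖ₑ ^ 2 = ‖x‖ₑ ^ 2 := by
  have h := hasSum_norm_inner_sq b x
  have := ENNReal.ofReal_tsum_of_nonneg (fun n => sq_nonneg ‖⟪b n, x⟫_ℂ‖) h.summable
  rw [h.tsum_eq] at this
  simp only [ENNReal.ofReal_pow (norm_nonneg _), ofReal_norm] at this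
  exact this.symm

theorem enorm_apply_le {T : H →L[ℂ] H} (hT : ‖T‖ ≤ 1) (x : H) : ‖T x‖ₑ ≤ ‖x‖ₑ := by
  rw [← ofReal_norm, ← ofReal_norm]
  exact ENNReal.ofReal_le_ofReal ((T.le_of_opNorm_le hT x).trans_eq (one_mul _))

/-- The trace of a positive operator, with values in `[0, ∞]`. -/
def traceENN (b : HilbertBasis ℕ ℂ H) (σ : H →L[ℂ] H) : ℝ≥0∞ :=
  ∑' n, ENNReal.ofReal (⟪b n, σ (b n)⟫_ℂ).re

theorem IsDensityOperator.traceENN_eq {b : HilbertBasis ℕ ℂ H} {σ : H →L[ℂ] H}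
    (hσ : IsDensityOperator b σ) : traceENN b σ = 1 := by
  have h := hσ.2.mapL Complex.reCLM
  rw [traceENN, ← ENNReal.ofReal_tsum_of_nonneg (f := fun n => (⟪b n, σ (b n)⟫_ℂ).re)
    (fun n => hσ.1.re_inner_nonneg_right (b n)) h.summable]
  erw [h.tsum_eq]
  simp

theorem isDensityOperator_rankOne (b : HilbertBasis ℕ ℂ H) {ψ : H} (hψ : ‖ψ‖ = 1) :
    IsDensityOperator b (InnerProductSpace.rankOne ℂ ψ ψ) := by
  refine ⟨InnerProductSpace.isPositive_rankOne_self ψ, ?_⟩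
  have h := b.hasSum_inner_mul_inner ψ ψ
  rw [inner_self_eq_norm_sq_to_K, hψ] at h
  simp only [InnerProductSpace.rankOne_apply, inner_smul_right]
  simpa using h

theorem ext_matrix (b : HilbertBasis ℕ ℂ H) {A B : H →L[ℂ] H}
    (h : ∀ n m, ⟪b n, A (b m)⟫_ℂ = ⟪b n, B (b m)⟫_ℂ) : A = B := by
  refine ContinuousLinearMap.ext_on (s := Set.range b) ?_ ?_
  · exact (Submodule.dense_iff_topologicalClosure_eq_top).2 b.dense_span
  · rintro _ ⟨m, rfl⟩
    refine b.repr.injective (lp.ext (funext fun n => ?_))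
    simpa only [b.repr_apply_apply] using h n m

variable [CompleteSpace H]

/-- The square of the Hilbert-Schmidt norm. -/
def hilbertSchmidtSq (b : HilbertBasis ℕ ℂ H) (A : H →L[ℂ] H) : ℝ≥0∞ :=
  ∑' n, ‖A (b n)‖ₑ ^ 2

/-- Parseval turns both sides into the double sum of squared matrix entries, and the order of
summation is exchanged. -/
theorem hilbertSchmidtSq_star (b : HilbertBasis ℕ ℂ H) (A : H →L[ℂ] H) :
    hilbertSchmidtSq b (star A) = hilbertSchmidtSq b A := by
  simp only [hilbertSchmidtSq, ← tsum_enorm_inner_sq b]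
  rw [ENNReal.tsum_comm]
  refine tsum_congr fun n => tsum_congr fun m => ?_
  rw [ContinuousLinearMap.star_eq_adjoint, ContinuousLinearMap.adjoint_inner_right,
    ← ofReal_norm, ← ofReal_norm, norm_inner_symm]

theorem hilbertSchmidtSq_mul_le (b : HilbertBasis ℕ ℂ H) (A : H →L[ℂ] H) {T : H →L[ℂ] H}
    (hT : ‖T‖ ≤ 1) : hilbertSchmidtSq b (A * T) ≤ hilbertSchmidtSq b A := by
  rw [← hilbertSchmidtSq_star b (A * T), ← hilbertSchmidtSq_star b A, star_mul]
  refine ENNReal.tsum_le_tsum fun n => ?_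
  gcongr
  exact enorm_apply_le ((norm_star T).trans_le hT) _

theorem enorm_sq_le_hilbertSchmidtSq (b : HilbertBasis ℕ ℂ H) (A : H →L[ℂ] H) :
    ‖A‖ₑ ^ 2 ≤ hilbertSchmidtSq b A := by
  rcases eq_or_ne (hilbertSchmidtSq b A) ∞ with h | h
  · simp [h]
  have key : ∀ x : H, ‖star A x‖ ≤ √(hilbertSchmidtSq b A).toReal * ‖x‖ := fun x => by
    have h1 : ‖star A x‖ₑ ^ 2 ≤ hilbertSchmidtSq b A * ‖x‖ₑ ^ 2 := by
      rw [← tsum_enorm_inner_sq b, hilbertSchmidtSq, ← ENNReal.tsum_mul_right]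
      refine ENNReal.tsum_le_tsum fun n => ?_
      rw [ContinuousLinearMap.star_eq_adjoint, ContinuousLinearMap.adjoint_inner_right, ← mul_pow]
      gcongr
      rw [← ofReal_norm, ← ofReal_norm, ← ofReal_norm, ← ENNReal.ofReal_mul (norm_nonneg _)]
      exact ENNReal.ofReal_le_ofReal (norm_inner_le_norm _ _)
    refine abs_le_of_sq_le_sq' ?_ (by positivity) |>.2
    rw [mul_pow, Real.sq_sqrt ENNReal.toReal_nonneg]
    have := ENNReal.toReal_mono (ENNReal.mul_ne_top h (by simp)) h1
    simpa using this
  have h2 := (star A).opNorm_le_bound (Real.sqrt_nonneg _) key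
  rw [norm_star] at h2
  have h3 := pow_le_pow_left₀ (norm_nonneg _) h2 2
  rw [Real.sq_sqrt ENNReal.toReal_nonneg] at h3
  rw [← ofReal_norm, ← ENNReal.ofReal_pow (norm_nonneg _)]
  exact ENNReal.ofReal_le_of_le_toReal h3

theorem exists_sqrt {σ : H →L[ℂ] H} (hσ : σ.IsPositive) :
    ∃ R : H →L[ℂ] H, star R = R ∧ R * R = σ := by
  have h0 : 0 ≤ σ := (ContinuousLinearMap.nonneg_iff_isPositive σ).2 hσ
  exact ⟨CFC.sqrt σ, (CFC.sqrt_nonneg σ).isSelfAdjoint.star_eq, CFC.sqrt_mul_sqrt_self σ h0⟩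

theorem inner_mul_self_left {R : H →L[ℂ] H} (hR : star R = R) (x y : H) :
    ⟪x, (R * R) y⟫_ℂ = ⟪R x, R y⟫_ℂ := by
  conv_rhs => rw [← hR]
  rw [ContinuousLinearMap.star_eq_adjoint, ContinuousLinearMap.adjoint_inner_left,
    ← ContinuousLinearMap.star_eq_adjoint, hR]
  rfl

theorem traceENN_mul_self (b : HilbertBasis ℕ ℂ H) {R : H →L[ℂ] H} (hR : star R = R) :
    traceENN b (R * R) = hilbertSchmidtSq b R := by
  refine tsum_congr fun n => ?_
  rw [inner_mul_self_left hR, ← ofReal_norm, ← ENNReal.ofReal_pow (norm_nonneg _)]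
  congr 1
  exact inner_self_eq_norm_sq (𝕜 := ℂ) _

/-- Write $\sigma=R^2$ with $R$ self-adjoint. Each diagonal entry is $\langle RT^*n, Rn\rangle$, so
AM–GM bounds twice the sum by the squared Hilbert–Schmidt norms of $RT^*$ and $R$. -/
theorem tsum_enorm_inner_mul_le (b : HilbertBasis ℕ ℂ H) {σ : H →L[ℂ] H} (hσ : σ.IsPositive)
    {T : H →L[ℂ] H} (hT : ‖T‖ ≤ 1) :
    ∑' n, ‖⟪b n, (T * σ) (b n)⟫_ℂ‖ₑ ≤ traceENN b σ := by
  obtain ⟨R, hR, rfl⟩ := exists_sqrt hσ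
  rw [traceENN_mul_self b hR]
  have h2 : ∀ n, 2 * ‖⟪b n, (T * (R * R)) (b n)⟫_ℂ‖ₑ
      ≤ ‖(R * star T) (b n)‖ₑ ^ 2 + ‖R (b n)‖ₑ ^ 2 := fun n => by
    have e : ⟪b n, (T * (R * R)) (b n)⟫_ℂ = ⟪(R * star T) (b n), R (b n)⟫_ℂ := by
      rw [mul_apply_eq_comp, ← ContinuousLinearMap.adjoint_inner_left,
        inner_mul_self_left hR]
      rfl
    rw [e]
    have h3 : 2 * ‖⟪(R * star T) (b n), R (b n)⟫_ℂ‖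
        ≤ ‖(R * star T) (b n)‖ ^ 2 + ‖R (b n)‖ ^ 2 := by
      have := norm_inner_le_norm (𝕜 := ℂ) ((R * star T) (b n)) (R (b n))
      nlinarith [two_mul_le_add_sq ‖(R * star T) (b n)‖ ‖R (b n)‖]
    have h4 := ENNReal.ofReal_le_ofReal h3
    rw [ENNReal.ofReal_mul zero_le_two, ENNReal.ofReal_add (by positivity) (by positivity),
      ENNReal.ofReal_pow (norm_nonneg _), ENNReal.ofReal_pow (norm_nonneg _)] at h4
    simpa only [ofReal_norm, ENNReal.ofReal_ofNat] using h4
  have h5 := ENNReal.tsum_le_tsum h2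
  rw [ENNReal.tsum_mul_left, ENNReal.tsum_add] at h5
  have h6 : 2 * ∑' n, ‖⟪b n, (T * (R * R)) (b n)⟫_ℂ‖ₑ ≤ 2 * hilbertSchmidtSq b R := by
    refine h5.trans ?_
    rw [two_mul]
    exact add_le_add (hilbertSchmidtSq_mul_le b R (by rwa [norm_star])) le_rfl
  rwa [ENNReal.mul_le_mul_iff_right two_ne_zero ENNReal.ofNat_ne_top] at h6

theorem IsDensityOperator.sum_norm_inner_mul_le {b : HilbertBasis ℕ ℂ H} {σ : H →L[ℂ] H}
    (hσ : IsDensityOperator b σ) {T : H →L[ℂ] H} (hT : ‖T‖ ≤ 1) (s : Finset ℕ) :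
    ∑ n ∈ s, ‖⟪b n, (T * σ) (b n)⟫_ℂ‖ ≤ 1 := by
  have h := (ENNReal.sum_le_tsum s).trans
    ((tsum_enorm_inner_mul_le b hσ.1 hT).trans_eq hσ.traceENN_eq)
  simp only [← ofReal_norm] at h
  rw [← ENNReal.ofReal_sum_of_nonneg (fun _ _ => norm_nonneg _)] at h
  simpa using h

theorem IsDensityOperator.summable_inner_mul {b : HilbertBasis ℕ ℂ H} {σ : H →L[ℂ] H}
    (hσ : IsDensityOperator b σ) {T : H →L[ℂ] H} (hT : ‖T‖ ≤ 1) :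
    Summable fun n => ⟪b n, (T * σ) (b n)⟫_ℂ :=
  (summable_of_sum_le (fun _ => norm_nonneg _) (hσ.sum_norm_inner_mul_le hT)).of_norm

/-- Polarisation and the parallelogram law pass from the quadratic form to the bilinear one. -/
theorem norm_le_one_of_abs_re_inner_le {T : H →L[ℂ] H} (hT : IsSelfAdjoint T)
    (h : ∀ x, |(⟪x, T x⟫_ℂ).re| ≤ ‖x‖ ^ 2) : ‖T‖ ≤ 1 := by
  refine T.opNorm_le_bound zero_le_one fun x => ?_
  rw [one_mul]
  have key : ∀ y z : H, 4 * (⟪y, T z⟫_ℂ).re ≤ 2 * ‖y‖ ^ 2 + 2 * ‖z‖ ^ 2 := fun y z => by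
    have h1 := (abs_le.1 (h (y + z))).2
    have h2 := (abs_le.1 (h (y - z))).1
    have h3 : (⟪z, T y⟫_ℂ).re = (⟪y, T z⟫_ℂ).re := by
      rw [← ContinuousLinearMap.adjoint_inner_left, ← ContinuousLinearMap.star_eq_adjoint,
        hT.star_eq]
      exact inner_re_symm (𝕜 := ℂ) _ _
    have h4 := parallelogram_law_with_norm ℂ y z
    simp only [map_add, map_sub, inner_add_left, inner_add_right, inner_sub_left, inner_sub_right,
      Complex.add_re, Complex.sub_re] at h1 h2
    nlinarith
  rcases eq_or_ne (T x) 0 with h0 | h0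
  · simp [h0]
  have hx : 0 < ‖x‖ := norm_pos_iff.2 fun e => h0 (by simp [e])
  have ht : 0 < ‖T x‖ := norm_pos_iff.2 h0
  -- The vector parallel to $Tx$ with the norm of $x$ makes the bound sharp.
  have h5 := key (((‖x‖ / ‖T x‖ : ℝ) : ℂ) • T x) x
  rw [inner_smul_left, inner_self_eq_norm_sq_to_K, norm_smul, Complex.conj_ofReal] at h5
  have e : ((((‖x‖ / ‖T x‖ : ℝ) : ℂ)) * ((‖T x‖ : ℂ)) ^ 2).re = ‖x‖ * ‖T x‖ := by
    norm_cast
    field_simp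
  have e2 : ‖((‖x‖ / ‖T x‖ : ℝ) : ℂ)‖ * ‖T x‖ = ‖x‖ := by
    rw [Complex.norm_real, Real.norm_of_nonneg (by positivity)]
    field_simp
  erw [e] at h5
  rw [e2] at h5
  nlinarith

theorem IsBinaryPOVM.norm_sub_le {P₁ P₂ : H →L[ℂ] H} (h : IsBinaryPOVM P₁ P₂) :
    ‖P₁ - P₂‖ ≤ 1 := by
  obtain ⟨h1, h2, h3⟩ := h
  refine norm_le_one_of_abs_re_inner_le (h1.isSelfAdjoint.sub h2.isSelfAdjoint) fun x => ?_
  have e : (⟪x, P₁ x⟫_ℂ).re + (⟪x, P₂ x⟫_ℂ).re = ‖x‖ ^ 2 := by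
    rw [← Complex.add_re, ← inner_add_right, ← add_apply, h3]
    exact inner_self_eq_norm_sq (𝕜 := ℂ) x
  have p1 : 0 ≤ (⟪x, P₁ x⟫_ℂ).re := h1.re_inner_nonneg_right x
  have p2 : 0 ≤ (⟪x, P₂ x⟫_ℂ).re := h2.re_inner_nonneg_right x
  rw [sub_apply, inner_sub_right, Complex.sub_re, abs_le]
  constructor <;> linarith

end

/-! ### Rotated states and their mixtures -/

section

variable {H : Type*} [NormedAddCommGroup H] [InnerProductSpace ℂ H] [CompleteSpace H]

theorem norm_le_of_summable_sq (b : HilbertBasis ℕ ℂ H) {A : H →L[ℂ] H}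
    (hA : Summable fun n => ‖A (b n)‖ ^ 2) : ‖A‖ ^ 2 ≤ ∑' n, ‖A (b n)‖ ^ 2 := by
  have h := enorm_sq_le_hilbertSchmidtSq b A
  simp only [hilbertSchmidtSq, ← ofReal_norm, ← ENNReal.ofReal_pow (norm_nonneg _)] at h
  rw [← ENNReal.ofReal_tsum_of_nonneg (fun _ => sq_nonneg _) hA] at h
  exact (ENNReal.ofReal_le_ofReal_iff (tsum_nonneg fun _ => sq_nonneg _)).1 h

theorem IsDensityOperator.exists_sqrt {b : HilbertBasis ℕ ℂ H} {σ : H →L[ℂ] H}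
    (hσ : IsDensityOperator b σ) :
    ∃ R : H →L[ℂ] H, star R = R ∧ R * R = σ ∧ Summable fun n => ‖R (b n)‖ ^ 2 := by
  obtain ⟨R, hR, e⟩ := BosonicDephasing.exists_sqrt hσ.1
  refine ⟨R, hR, e, ?_⟩
  have h := hσ.2.mapL Complex.reCLM
  refine h.summable.congr fun n => ?_
  rw [← e, inner_mul_self_left hR]
  exact inner_self_eq_norm_sq (𝕜 := ℂ) _

theorem star_phaseOp_apply_fock (b : HilbertBasis ℕ ℂ H) (θ : ℝ) (n : ℕ) :
    star (phaseOp b θ) (b n) = Complex.exp (Complex.I * n * θ) • b n := by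
  have h : star (phaseOp b θ) (phase b θ (b n)) = b n := by
    rw [ContinuousLinearMap.star_eq_adjoint, phaseOp]
    erw [LinearIsometryEquiv.adjoint_eq_symm]
    exact (phase b θ).symm_apply_apply _
  rw [phase_apply_fock, map_smul] at h
  conv_rhs => rw [← h]
  rw [smul_smul, ← Complex.exp_add, add_neg_cancel, Complex.exp_zero, one_smul]

theorem norm_phaseOp_le (b : HilbertBasis ℕ ℂ H) (θ : ℝ) : ‖phaseOp b θ‖ ≤ 1 :=
  (phaseOp b θ).opNorm_le_bound zero_le_one fun x => by
    rw [one_mul]; exact ((phase b θ).norm_map x).le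

/-- The rotated operator `e^{-i a†a θ} ρ e^{i a†a θ}`. -/
def rotate (b : HilbertBasis ℕ ℂ H) (ρ : H →L[ℂ] H) (θ : ℝ) : H →L[ℂ] H :=
  phaseOp b θ * ρ * star (phaseOp b θ)

theorem inner_rotate (b : HilbertBasis ℕ ℂ H) (ρ : H →L[ℂ] H) (θ : ℝ) (x y : H) :
    ⟪x, rotate b ρ θ y⟫_ℂ = ⟪star (phaseOp b θ) x, ρ (star (phaseOp b θ) y)⟫_ℂ := by
  rw [ContinuousLinearMap.star_eq_adjoint, ContinuousLinearMap.adjoint_inner_left]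
  rfl

theorem inner_rotate_fock (b : HilbertBasis ℕ ℂ H) (ρ : H →L[ℂ] H) (θ : ℝ) (n m : ℕ) :
    ⟪b n, rotate b ρ θ (b m)⟫_ℂ
      = Complex.exp (((m - n : ℤ) : ℂ) * θ * Complex.I) * ⟪b n, ρ (b m)⟫_ℂ := by
  rw [inner_rotate, star_phaseOp_apply_fock, star_phaseOp_apply_fock, map_smul, inner_smul_left,
    inner_smul_right, ← Complex.exp_conj, ← mul_assoc, ← Complex.exp_add]
  congr 2
  simp only [map_mul, Complex.conj_I, Complex.conj_ofReal, Complex.conj_natCast]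
  push_cast
  ring

theorem norm_rotate_le (b : HilbertBasis ℕ ℂ H) (ρ : H →L[ℂ] H) (θ : ℝ) :
    ‖rotate b ρ θ‖ ≤ ‖ρ‖ := by
  refine (norm_mul_le _ _).trans ?_
  have h1 := norm_phaseOp_le b θ
  have h2 : ‖star (phaseOp b θ)‖ ≤ 1 := (norm_star _).trans_le h1
  have h3 : ‖phaseOp b θ * ρ‖ ≤ ‖ρ‖ :=
    (norm_mul_le _ _).trans (mul_le_of_le_one_left (norm_nonneg _) h1)
  exact (mul_le_of_le_one_right (norm_nonneg _) h2).trans h3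

theorem IsDensityOperator.rotate {b : HilbertBasis ℕ ℂ H} {ρ : H →L[ℂ] H}
    (hρ : IsDensityOperator b ρ) (θ : ℝ) : IsDensityOperator b (rotate b ρ θ) := by
  refine ⟨?_, ?_⟩
  · have := hρ.1.conj_adjoint (phaseOp b θ)
    rwa [← ContinuousLinearMap.star_eq_adjoint] at this
  · simpa [inner_rotate_fock] using hρ.2

/-- The rotations are only strongly continuous; a Hilbert–Schmidt factor makes the product norm
continuous. The Hilbert–Schmidt norm of the difference tends to zero by dominated convergence and
controls the operator norm. -/
theorem continuous_mul_star_phaseOp (b : HilbertBasis ℕ ℂ H) {R : H →L[ℂ] H}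
    (hR : Summable fun n => ‖R (b n)‖ ^ 2) : Continuous fun θ => R * star (phaseOp b θ) := by
  have app : ∀ θ θ₀ : ℝ, ∀ n, ‖(R * star (phaseOp b θ) - R * star (phaseOp b θ₀)) (b n)‖ ^ 2
      = ‖Complex.exp (Complex.I * n * θ) - Complex.exp (Complex.I * n * θ₀)‖ ^ 2
        * ‖R (b n)‖ ^ 2 := fun θ θ₀ n => by
    rw [sub_apply, mul_apply_eq_comp, mul_apply_eq_comp, star_phaseOp_apply_fock,
      star_phaseOp_apply_fock, map_smul, map_smul, ← sub_smul, norm_smul, mul_pow]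
  have bd : ∀ θ θ₀ : ℝ, ∀ n : ℕ,
      ‖Complex.exp (Complex.I * n * θ) - Complex.exp (Complex.I * n * θ₀)‖ ^ 2 * ‖R (b n)‖ ^ 2
        ≤ 4 * ‖R (b n)‖ ^ 2 := fun θ θ₀ n => by
    have h1 : ∀ t : ℝ, ‖Complex.exp (Complex.I * n * t)‖ = 1 := fun t => by
      rw [show Complex.I * n * t = ((n * t : ℝ) : ℂ) * Complex.I by push_cast; ring]
      exact Complex.norm_exp_ofReal_mul_I _
    have h2 := norm_sub_le (Complex.exp (Complex.I * n * θ)) (Complex.exp (Complex.I * n * θ₀))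
    rw [h1, h1] at h2
    gcongr
    nlinarith [norm_nonneg (Complex.exp (Complex.I * n * θ) - Complex.exp (Complex.I * n * θ₀))]
  rw [continuous_iff_continuousAt]
  intro θ₀
  have lim : Tendsto (fun θ : ℝ => ∑' n : ℕ,
      ‖Complex.exp (Complex.I * n * θ) - Complex.exp (Complex.I * n * θ₀)‖ ^ 2 * ‖R (b n)‖ ^ 2)
      (𝓝 θ₀) (𝓝 (∑' n : ℕ, 0)) := by
    refine tendsto_tsum_of_dominated_convergence (hR.mul_left 4) (fun n => ?_)
      (Eventually.of_forall fun θ n => ?_)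
    · have : Continuous fun θ : ℝ => ‖Complex.exp (Complex.I * n * θ)
          - Complex.exp (Complex.I * n * θ₀)‖ ^ 2 * ‖R (b n)‖ ^ 2 := by fun_prop
      simpa using this.tendsto θ₀
    · rw [Real.norm_of_nonneg (by positivity)]
      exact bd θ θ₀ n
  rw [tsum_zero] at lim
  have lim2 : Tendsto (fun θ : ℝ => ‖R * star (phaseOp b θ) - R * star (phaseOp b θ₀)‖ ^ 2)
      (𝓝 θ₀) (𝓝 0) := by
    refine squeeze_zero (fun _ => sq_nonneg _) (fun θ => ?_) lim
    have hs : Summable fun n =>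
        ‖(R * star (phaseOp b θ) - R * star (phaseOp b θ₀)) (b n)‖ ^ 2 :=
      Summable.of_nonneg_of_le (fun _ => sq_nonneg _)
        (fun n => (app θ θ₀ n).trans_le (bd θ θ₀ n)) (hR.mul_left 4)
    refine (norm_le_of_summable_sq b hs).trans_eq (tsum_congr fun n => app θ θ₀ n)
  refine tendsto_iff_norm_sub_tendsto_zero.2 ?_
  have := (Real.continuous_sqrt.tendsto _).comp lim2
  rw [Real.sqrt_zero] at this
  exact this.congr fun θ => Real.sqrt_sq (norm_nonneg _)

/-- With $\rho=R^2$ the rotated state is $(RU_\theta^*)^*(RU_\theta^*)$. Continuity provides the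
measurability needed for Bochner integrals. -/
theorem IsDensityOperator.continuous_rotate {b : HilbertBasis ℕ ℂ H} {ρ : H →L[ℂ] H}
    (hρ : IsDensityOperator b ρ) : Continuous (BosonicDephasing.rotate b ρ) := by
  obtain ⟨R, hR, rfl, hs⟩ := hρ.exists_sqrt
  have h := continuous_mul_star_phaseOp b hs
  have e : BosonicDephasing.rotate b (R * R)
      = fun θ => star (R * star (phaseOp b θ)) * (R * star (phaseOp b θ)) := by
    funext θ
    rw [star_mul, star_star, hR, BosonicDephasing.rotate]
    simp only [mul_assoc]
  rw [e]
  exact h.star.mul h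

/-- The mixture `∫ g(θ) e^{-i a†a θ} ρ e^{i a†a θ} dμ(θ)` of rotated operators. -/
def twirl (b : HilbertBasis ℕ ℂ H) (μ : Measure ℝ) (g : ℝ → ℝ) (ρ : H →L[ℂ] H) : H →L[ℂ] H :=
  ∫ θ, (g θ : ℂ) • rotate b ρ θ ∂μ

section twirl

variable {b : HilbertBasis ℕ ℂ H} {ρ : H →L[ℂ] H} {μ : Measure ℝ} {g : ℝ → ℝ}

theorem IsDensityOperator.integrable_smul_rotate (hρ : IsDensityOperator b ρ)
    (hg : Integrable g μ) :
    Integrable (fun θ => (g θ : ℂ) • BosonicDephasing.rotate b ρ θ) μ := by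
  have h : Integrable (fun θ => (g θ : ℂ)) μ := hg.ofReal
  exact Integrable.smul_bdd (φ := fun θ => (g θ : ℂ)) (C := ‖ρ‖) h
    hρ.continuous_rotate.aestronglyMeasurable
    (Eventually.of_forall fun θ => norm_rotate_le b ρ θ)

theorem IsDensityOperator.apply_twirl (hρ : IsDensityOperator b ρ) (hg : Integrable g μ)
    (L : (H →L[ℂ] H) →L[ℂ] ℂ) :
    L (twirl b μ g ρ) = ∫ θ, (g θ : ℂ) * L (BosonicDephasing.rotate b ρ θ) ∂μ := by
  rw [twirl, ← L.integral_comp_comm (hρ.integrable_smul_rotate hg)]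
  simp only [map_smul, smul_eq_mul]

/-- The functional `A ↦ ∑_{n ∈ s} ⟨n|T A|n⟩`. -/
def partialTrace (b : HilbertBasis ℕ ℂ H) (T : H →L[ℂ] H) (s : Finset ℕ) :
    (H →L[ℂ] H) →L[ℂ] ℂ :=
  ∑ n ∈ s, (innerSL ℂ (b n)).comp
    ((ContinuousLinearMap.apply ℂ H (b n)).comp (ContinuousLinearMap.mul ℂ (H →L[ℂ] H) T))

theorem partialTrace_apply (b : HilbertBasis ℕ ℂ H) (T : H →L[ℂ] H) (s : Finset ℕ)
    (A : H →L[ℂ] H) : partialTrace b T s A = ∑ n ∈ s, ⟪b n, (T * A) (b n)⟫_ℂ := by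
  simp [partialTrace]

theorem IsDensityOperator.inner_twirl (hρ : IsDensityOperator b ρ) (hg : Integrable g μ)
    (x y : H) :
    ⟪x, twirl b μ g ρ y⟫_ℂ = ∫ θ, (g θ : ℂ) * ⟪x, BosonicDephasing.rotate b ρ θ y⟫_ℂ ∂μ :=
  hρ.apply_twirl hg ((innerSL ℂ x).comp (ContinuousLinearMap.apply ℂ H y))

theorem IsDensityOperator.inner_twirl_fock (hρ : IsDensityOperator b ρ) (hg : Integrable g μ)
    (n m : ℕ) :
    ⟪b n, twirl b μ g ρ (b m)⟫_ℂ
      = (∫ θ, (g θ : ℂ) * Complex.exp (((m - n : ℤ) : ℂ) * θ * Complex.I) ∂μ)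
        * ⟪b n, ρ (b m)⟫_ℂ := by
  rw [hρ.inner_twirl hg, ← integral_mul_const]
  simp only [inner_rotate_fock, mul_assoc]

/-- Finite partial traces are norm continuous, unlike the trace, so they commute with the integral;
the bound is uniform in `s`. -/
theorem IsDensityOperator.norm_sum_inner_mul_twirl_le (hρ : IsDensityOperator b ρ)
    (hg : Integrable g μ) {T : H →L[ℂ] H} (hT : ‖T‖ ≤ 1) (s : Finset ℕ) :
    ‖∑ n ∈ s, ⟪b n, (T * twirl b μ g ρ) (b n)⟫_ℂ‖ ≤ ∫ θ, |g θ| ∂μ := by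
  rw [← partialTrace_apply, hρ.apply_twirl hg]
  refine norm_integral_le_of_norm_le hg.abs (Eventually.of_forall fun θ => ?_)
  rw [norm_mul, Complex.norm_real, Real.norm_eq_abs, partialTrace_apply]
  exact mul_le_of_le_one_right (abs_nonneg _)
    ((norm_sum_le _ _).trans ((hρ.rotate θ).sum_norm_inner_mul_le hT s))

theorem IsDensityOperator.isSelfAdjoint_twirl (hρ : IsDensityOperator b ρ)
    (hg : Integrable g μ) : IsSelfAdjoint (twirl b μ g ρ) := by
  rw [ContinuousLinearMap.isSelfAdjoint_iff_isSymmetric]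
  intro x y
  change ⟪twirl b μ g ρ x, y⟫_ℂ = ⟪x, twirl b μ g ρ y⟫_ℂ
  rw [← inner_conj_symm, hρ.inner_twirl hg, hρ.inner_twirl hg, ← integral_conj]
  refine integral_congr_ae (Eventually.of_forall fun θ => ?_)
  simp only [map_mul, Complex.conj_ofReal, inner_conj_symm]
  rw [(hρ.rotate θ).1.inner_left_eq_inner_right]

theorem IsDensityOperator.isPositive_twirl (hρ : IsDensityOperator b ρ)
    (hg : Integrable g μ) (h0 : ∀ θ, 0 ≤ g θ) : (twirl b μ g ρ).IsPositive := by
  rw [ContinuousLinearMap.isPositive_def']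
  refine ⟨hρ.isSelfAdjoint_twirl hg, fun x => ?_⟩
  rw [ContinuousLinearMap.reApplyInnerSelf, inner_re_symm, hρ.inner_twirl hg]
  rw [← integral_re]
  · refine integral_nonneg fun θ => ?_
    change 0 ≤ ((g θ : ℂ) * _).re
    rw [Complex.re_ofReal_mul]
    exact mul_nonneg (h0 θ) ((hρ.rotate θ).1.re_inner_nonneg_right x)
  · exact ((innerSL ℂ x).comp (ContinuousLinearMap.apply ℂ H x)).integrable_comp
      (hρ.integrable_smul_rotate hg) |>.congr (Eventually.of_forall fun θ => by simp)

end twirl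

end

/-! ### The discrepancy as a mixture over one period; upper bounds -/

section

variable {H : Type*} [NormedAddCommGroup H] [InnerProductSpace ℂ H] [CompleteSpace H]

/-- The difference `q₁ p_{γ₁} - q₂ p_{γ₂}` of weighted wrapped normal densities. -/
def densityDiff (γ₁ γ₂ : ℝ≥0) (q₁ q₂ : ℝ) (θ : ℝ) : ℝ :=
  q₁ * wrappedNormal γ₁ θ - q₂ * wrappedNormal γ₂ θ

/-- Lebesgue measure on the period `(-π, π]`. -/
abbrev periodMeasure : Measure ℝ := volume.restrict (Set.Ioc (-Real.pi) Real.pi)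

theorem integrable_periodMeasure {E : Type*} [NormedAddCommGroup E] {g : ℝ → E}
    (hg : Continuous g) : Integrable g periodMeasure :=
  hg.integrableOn_Icc.mono_set Set.Ioc_subset_Icc_self

theorem continuous_densityDiff {γ₁ γ₂ : ℝ≥0} (hγ₁ : 0 < γ₁) (hγ₂ : 0 < γ₂) (q₁ q₂ : ℝ) :
    Continuous (densityDiff γ₁ γ₂ q₁ q₂) :=
  (continuous_const.mul (continuous_wrappedNormal hγ₁)).sub
    (continuous_const.mul (continuous_wrappedNormal hγ₂))

theorem dephasing_eq_twirl (b : HilbertBasis ℕ ℂ H) (γ : ℝ≥0) (ρ : H →L[ℂ] H) :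
    dephasing b γ ρ = twirl b (ProbabilityTheory.gaussianReal 0 γ) (fun _ => 1) ρ := by
  simp only [dephasing, twirl, rotate, Complex.ofReal_one, one_smul]

section density

variable {b : HilbertBasis ℕ ℂ H} {ρ : H →L[ℂ] H}

theorem IsDensityOperator.inner_dephasing_fock (hρ : IsDensityOperator b ρ) (γ : ℝ≥0) (n m : ℕ) :
    ⟪b n, dephasing b γ ρ (b m)⟫_ℂ = gaussCoeff γ (m - n) * ⟪b n, ρ (b m)⟫_ℂ := by
  rw [dephasing_eq_twirl, hρ.inner_twirl_fock (integrable_const _)]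
  simp only [Complex.ofReal_one, one_mul, integral_gaussianReal_exp]

theorem IsDensityOperator.dephasing (hρ : IsDensityOperator b ρ) (γ : ℝ≥0) :
    IsDensityOperator b (dephasing b γ ρ) := by
  refine ⟨?_, ?_⟩
  · rw [dephasing_eq_twirl]
    exact hρ.isPositive_twirl (integrable_const _) fun _ => zero_le_one
  · simpa [hρ.inner_dephasing_fock, gaussCoeff] using hρ.2

theorem IsDensityOperator.inner_twirl_densityDiff_fock (hρ : IsDensityOperator b ρ) {γ₁ γ₂ : ℝ≥0}
    (hγ₁ : 0 < γ₁) (hγ₂ : 0 < γ₂) (q₁ q₂ : ℝ) (n m : ℕ) :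
    ⟪b n, twirl b periodMeasure (densityDiff γ₁ γ₂ q₁ q₂) ρ (b m)⟫_ℂ
      = (q₁ * gaussCoeff γ₁ (m - n) - q₂ * gaussCoeff γ₂ (m - n)) * ⟪b n, ρ (b m)⟫_ℂ := by
  rw [hρ.inner_twirl_fock (integrable_periodMeasure (continuous_densityDiff hγ₁ hγ₂ q₁ q₂)),
    ← integral_wrappedNormal_mul_exp hγ₁, ← integral_wrappedNormal_mul_exp hγ₂,
    ← integral_const_mul, ← integral_const_mul, ← integral_sub]
  · congr 2
    funext θ
    rw [densityDiff]
    push_cast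
    ring
  all_goals
    refine integrable_periodMeasure (continuous_const.mul (Continuous.mul ?_ (by fun_prop)))
    exact Complex.continuous_ofReal.comp (continuous_wrappedNormal ‹_›)

/-- Both sides multiply the matrix of `ρ` entrywise by the same Fourier coefficients. -/
theorem IsDensityOperator.discrepancy_eq_twirl (hρ : IsDensityOperator b ρ) {γ₁ γ₂ : ℝ≥0}
    (hγ₁ : 0 < γ₁) (hγ₂ : 0 < γ₂) (q₁ q₂ : ℝ) :
    discrepancy b γ₁ γ₂ q₁ q₂ ρ
      = twirl b periodMeasure (densityDiff γ₁ γ₂ q₁ q₂) ρ := by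
  refine ext_matrix b fun n m => ?_
  rw [hρ.inner_twirl_densityDiff_fock hγ₁ hγ₂, discrepancy, sub_apply, inner_sub_right]
  simp only [smul_apply, inner_smul_right, hρ.inner_dephasing_fock]
  ring

/-- The contraction $S=A/(|A|+\varepsilon)$ is a continuous substitute for the sign of $A$:
$|x|-x^2/(|x|+\varepsilon)=\varepsilon|x|/(|x|+\varepsilon)\le\varepsilon$. -/
theorem inner_abs_le_add {A : H →L[ℂ] H} (hA : IsSelfAdjoint A) {ε : ℝ} (hε : 0 < ε) :
    ∃ S : H →L[ℂ] H, ‖S‖ ≤ 1 ∧ ∀ x : H,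
      (⟪x, CFC.sqrt (star A * A) x⟫_ℂ).re ≤ (⟪x, (S * A) x⟫_ℂ).re + ε * ‖x‖ ^ 2 := by
  have hpos : ∀ x : ℝ, 0 < |x| + ε := fun x => by positivity
  have hc : Continuous fun x : ℝ => x / (|x| + ε) :=
    continuous_id.div (continuous_abs.add continuous_const) fun x => (hpos x).ne'
  refine ⟨cfc (fun x : ℝ => x / (|x| + ε)) A, ?_, fun x => ?_⟩
  · refine norm_cfc_le zero_le_one fun x _ => ?_
    rw [Real.norm_eq_abs, abs_div, abs_of_pos (hpos x), div_le_one (hpos x)]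
    linarith
  · have h1 : CFC.sqrt (star A * A) = cfc (fun x : ℝ => ‖x‖) A := CFC.abs_eq_cfc_norm A hA
    have h2 : cfc (fun x : ℝ => x / (|x| + ε)) A * A = cfc (fun x : ℝ => x / (|x| + ε) * x) A := by
      conv_lhs => enter [2]; rw [← cfc_id ℝ A hA]
      rw [← cfc_mul _ _ A hc.continuousOn continuousOn_id]
      rfl
    have h3 : CFC.sqrt (star A * A)
        ≤ cfc (fun x : ℝ => x / (|x| + ε)) A * A + algebraMap ℝ (H →L[ℂ] H) ε := by
      rw [h1, h2, ← cfc_add_const ε (fun x : ℝ => x / (|x| + ε) * x) A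
        (hc.mul continuous_id).continuousOn hA]
      refine cfc_mono (fun x _ => ?_) (by fun_prop)
        ((hc.mul continuous_id).add continuous_const).continuousOn
      rw [Real.norm_eq_abs, div_mul_eq_mul_div, ← sub_le_iff_le_add, le_div_iff₀ (hpos x)]
      nlinarith [abs_mul_abs_self x, abs_nonneg x]
    have h4 := ((ContinuousLinearMap.le_def _ _).1 h3).re_inner_nonneg_right x
    have h5 : (⟪x, (ε : ℝ) • x⟫_ℂ).re = ε * ‖x‖ ^ 2 := by
      rw [← Complex.coe_smul, inner_smul_right, Complex.re_ofReal_mul]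
      congr 1
      exact inner_self_eq_norm_sq (𝕜 := ℂ) x
    rw [sub_apply, add_apply, inner_sub_right, inner_add_right, Algebra.algebraMap_eq_smul_one]
      at h4
    simp only [smul_apply, one_apply_eq_self] at h4
    change 0 ≤ (_ - _ : ℂ).re at h4
    rw [Complex.sub_re, Complex.add_re, h5] at h4
    linarith

theorem traceNorm_le_of_partial_sums (b : HilbertBasis ℕ ℂ H) {A : H →L[ℂ] H}
    (hA : IsSelfAdjoint A) {C : ℝ}
    (h : ∀ T : H →L[ℂ] H, ‖T‖ ≤ 1 → ∀ s : Finset ℕ, ‖∑ n ∈ s, ⟪b n, (T * A) (b n)⟫_ℂ‖ ≤ C) :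
    traceNorm b A ≤ ENNReal.ofReal C := by
  refine ENNReal.tsum_le_of_sum_range_le fun N => ?_
  have hnn : 0 ≤ CFC.sqrt (star A * A) := CFC.sqrt_nonneg _
  rw [← ENNReal.ofReal_sum_of_nonneg (f := fun n => (⟪b n, CFC.sqrt (star A * A) (b n)⟫_ℂ).re)
    fun n _ => ((ContinuousLinearMap.nonneg_iff_isPositive _).1 hnn).re_inner_nonneg_right (b n)]
  refine ENNReal.ofReal_le_ofReal (le_of_forall_pos_le_add fun ε hε => ?_)
  -- The error is spread over `N` unit vectors and stays below `ε` in total.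
  obtain ⟨S, hS, hSA⟩ := inner_abs_le_add hA (ε := ε / (N + 1)) (by positivity)
  have h1 : ∑ n ∈ Finset.range N, (⟪b n, CFC.sqrt (star A * A) (b n)⟫_ℂ).re
      ≤ ∑ n ∈ Finset.range N, ((⟪b n, (S * A) (b n)⟫_ℂ).re + ε / (N + 1)) :=
    Finset.sum_le_sum fun n _ => by simpa [b.orthonormal.1 n] using hSA (b n)
  rw [Finset.sum_add_distrib, Finset.sum_const, Finset.card_range,
    nsmul_eq_mul] at h1
  have h2 : (N : ℝ) * (ε / (N + 1)) ≤ ε := by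
    rw [← mul_div_assoc, div_le_iff₀ (by positivity)]
    nlinarith
  have h3 := (Complex.re_le_norm _).trans (h S hS (Finset.range N))
  rw [Complex.re_sum] at h3
  linarith

theorem IsDensityOperator.traceNorm_twirl_le (hρ : IsDensityOperator b ρ) {μ : Measure ℝ}
    {g : ℝ → ℝ} (hg : Integrable g μ) :
    traceNorm b (twirl b μ g ρ) ≤ ENNReal.ofReal (∫ θ, |g θ| ∂μ) :=
  traceNorm_le_of_partial_sums b (hρ.isSelfAdjoint_twirl hg) fun _ hT s =>
    hρ.norm_sum_inner_mul_twirl_le hg hT s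

theorem IsDensityOperator.norm_trace_mul_twirl_le (hρ : IsDensityOperator b ρ) {μ : Measure ℝ}
    {g : ℝ → ℝ} (hg : Integrable g μ) {T : H →L[ℂ] H} (hT : ‖T‖ ≤ 1) :
    ‖trace b (T * twirl b μ g ρ)‖ ≤ ∫ θ, |g θ| ∂μ := by
  by_cases hs : Summable fun n => ⟪b n, (T * twirl b μ g ρ) (b n)⟫_ℂ
  · exact le_of_tendsto' (hs.hasSum.norm) fun s => hρ.norm_sum_inner_mul_twirl_le hg hT s
  -- Without summability `trace` takes the default value 0, and the bound is trivial.
  · rw [trace, tsum_eq_zero_of_not_summable hs, norm_zero]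
    exact integral_nonneg fun _ => abs_nonneg _

/-- Helstrom's reduction: $\Pi_{1,2}=(1\pm T)/2$, and the dephased states have trace one. -/
theorem IsDensityOperator.errorProbability_eq (hρ : IsDensityOperator b ρ) (γ₁ γ₂ : ℝ≥0)
    {q₁ q₂ : ℝ} (hq : q₁ + q₂ = 1) {P₁ P₂ : H →L[ℂ] H} (hP : IsBinaryPOVM P₁ P₂) :
    errorProbability b γ₁ γ₂ q₁ q₂ ρ P₁ P₂
      = (1 - (trace b ((P₁ - P₂) * discrepancy b γ₁ γ₂ q₁ q₂ ρ)).re) / 2 := by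
  set T := P₁ - P₂ with hTdef
  have hT : ‖T‖ ≤ 1 := hP.norm_sub_le
  have s : ∀ γ, HasSum (fun n => ⟪b n, (T * BosonicDephasing.dephasing b γ ρ) (b n)⟫_ℂ)
      (trace b (T * BosonicDephasing.dephasing b γ ρ)) := fun γ =>
    ((hρ.dephasing γ).summable_inner_mul hT).hasSum
  have e1 : P₁ = (1 / 2 : ℂ) • (1 + T) := by
    rw [← hP.2.2, hTdef, show P₁ + P₂ + (P₁ - P₂) = (2 : ℂ) • P₁ by rw [two_smul]; abel, smul_smul]
    norm_num
  have e2 : P₂ = (1 / 2 : ℂ) • (1 - T) := by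
    rw [← hP.2.2, hTdef, show P₁ + P₂ - (P₁ - P₂) = (2 : ℂ) • P₂ by rw [two_smul]; abel, smul_smul]
    norm_num
  have t1 : ∀ γ, trace b (P₁ * BosonicDephasing.dephasing b γ ρ)
      = 1 / 2 * (1 + trace b (T * BosonicDephasing.dephasing b γ ρ)) := fun γ => by
    refine HasSum.tsum_eq ?_
    refine (((hρ.dephasing γ).2.add (s γ)).mul_left (1 / 2)).congr_fun fun n => ?_
    simp [e1, add_mul]
    ring
  have t2 : ∀ γ, trace b (P₂ * BosonicDephasing.dephasing b γ ρ)
      = 1 / 2 * (1 - trace b (T * BosonicDephasing.dephasing b γ ρ)) := fun γ => by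
    refine HasSum.tsum_eq ?_
    refine (((hρ.dephasing γ).2.sub (s γ)).mul_left (1 / 2)).congr_fun fun n => ?_
    simp [e2, sub_mul]
  have t3 : trace b (T * discrepancy b γ₁ γ₂ q₁ q₂ ρ)
      = q₁ * trace b (T * BosonicDephasing.dephasing b γ₁ ρ)
        - q₂ * trace b (T * BosonicDephasing.dephasing b γ₂ ρ) := by
    refine HasSum.tsum_eq ?_
    refine (((s γ₁).mul_left (q₁ : ℂ)).sub ((s γ₂).mul_left (q₂ : ℂ))).congr_fun fun n => ?_
    simp [discrepancy, mul_sub]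
  rw [errorProbability, t1, t2, t3]
  have half : (1 / 2 : ℂ) = ((1 / 2 : ℝ) : ℂ) := by norm_num
  simp only [half, Complex.re_ofReal_mul, Complex.sub_re, Complex.add_re, Complex.one_re]
  linarith

end density

end

/-! ### Attainment by uniform superpositions and Toeplitz tests -/

section

/-- Enlarging the block adds one row and one column. Subtracting `a 0` corrects for the corner,
which `k = 0` counts twice. -/
theorem sum_range_sum_range_sub_succ (a : ℤ → ℂ) (N : ℕ) :
    ∑ n ∈ Finset.range (N + 1), ∑ m ∈ Finset.range (N + 1), a (m - n)
      = (∑ n ∈ Finset.range N, ∑ m ∈ Finset.range N, a (m - n))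
        + (∑ k ∈ Finset.range (N + 1), (a k + a (-k)) - a 0) := by
  have h1 : ∑ n ∈ Finset.range N, a (N - n) = ∑ k ∈ Finset.range N, a (k + 1) := by
    rw [← Finset.sum_range_reflect]
    refine Finset.sum_congr rfl fun k hk => ?_
    have := Finset.mem_range.1 hk
    congr 1
    omega
  have h2 : ∑ n ∈ Finset.range N, a (n - N) = ∑ k ∈ Finset.range N, a (-(k + 1)) := by
    rw [← Finset.sum_range_reflect]
    refine Finset.sum_congr rfl fun k hk => ?_
    have := Finset.mem_range.1 hk
    congr 1
    omega
  rw [Finset.sum_range_succ' (fun k : ℕ => a k + a (-k)) N]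
  simp only [Finset.sum_range_succ, Finset.sum_add_distrib, sub_self, h1, h2]
  push_cast
  simp only [neg_zero]
  ring

/-- The block sum is the sum of the first `N` symmetric partial sums of `a`, so its mean is a Cesàro
mean. -/
theorem tendsto_toeplitz_mean {a : ℤ → ℂ} {A : ℂ} (h : HasSum a A) :
    Tendsto (fun N : ℕ => (N : ℝ)⁻¹ •
      ∑ n ∈ Finset.range N, ∑ m ∈ Finset.range N, a (m - n)) atTop (𝓝 A) := by
  have h1 := ((h.nat_add_neg.tendsto_sum_nat.comp (tendsto_add_atTop_nat 1)).sub_const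
    (a 0)).cesaro_smul
  rw [add_sub_cancel_right] at h1
  refine h1.congr fun N => ?_
  congr 1
  induction N with
  | zero => simp
  | succ N ih => rw [Finset.sum_range_succ, ih, sum_range_sum_range_sub_succ]; rfl

variable {H : Type*} [NormedAddCommGroup H] [InnerProductSpace ℂ H]

/-- The uniform superposition `N^{-1/2} (|0⟩ + ⋯ + |N-1⟩)`. -/
def uniformState (b : HilbertBasis ℕ ℂ H) (N : ℕ) : H :=
  ((√N)⁻¹ : ℂ) • ∑ n ∈ Finset.range N, b n

theorem inner_uniformState (b : HilbertBasis ℕ ℂ H) (N n : ℕ) :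
    ⟪b n, uniformState b N⟫_ℂ = if n < N then ((√N)⁻¹ : ℂ) else 0 := by
  classical
  rw [uniformState, inner_smul_right, inner_sum]
  simp only [orthonormal_iff_ite.1 b.orthonormal, Finset.sum_ite_eq, Finset.mem_range, mul_ite,
    mul_one, mul_zero]

theorem norm_uniformState (b : HilbertBasis ℕ ℂ H) {N : ℕ} (hN : N ≠ 0) :
    ‖uniformState b N‖ = 1 := by
  have h := hasSum_norm_inner_sq b (uniformState b N)
  have h2 := hasSum_sum_of_ne_finset_zero (f := fun n => ‖⟪b n, uniformState b N⟫_ℂ‖ ^ 2)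
    (s := Finset.range N) (L := .unconditional ℕ) fun n hn => by
      rw [inner_uniformState, if_neg (by simpa using hn)]; simp
  have h3 : ∑ n ∈ Finset.range N, ‖⟪b n, uniformState b N⟫_ℂ‖ ^ 2 = 1 := by
    have : ∀ n ∈ Finset.range N, ‖⟪b n, uniformState b N⟫_ℂ‖ ^ 2 = (N : ℝ)⁻¹ := fun n hn => by
      rw [inner_uniformState, if_pos (by simpa using hn), norm_inv, Complex.norm_real,
        Real.norm_of_nonneg (Real.sqrt_nonneg _), inv_pow, Real.sq_sqrt N.cast_nonneg]
    rw [Finset.sum_congr rfl this, Finset.sum_const, Finset.card_range, nsmul_eq_mul,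
      mul_inv_cancel₀ (by exact_mod_cast hN)]
  have h4 := h.unique h2
  rw [h3] at h4
  exact (pow_eq_one_iff_of_nonneg (norm_nonneg _) two_ne_zero).1 h4

/-- The pure state of the uniform superposition. -/
def uniformPure (b : HilbertBasis ℕ ℂ H) (N : ℕ) : H →L[ℂ] H :=
  InnerProductSpace.rankOne ℂ (uniformState b N) (uniformState b N)

theorem inner_uniformPure (b : HilbertBasis ℕ ℂ H) (N n m : ℕ) :
    ⟪b n, uniformPure b N (b m)⟫_ℂ = if n < N ∧ m < N then ((N : ℂ))⁻¹ else 0 := by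
  have h : ((√N)⁻¹ : ℂ) * ((√N)⁻¹ : ℂ) = (N : ℂ)⁻¹ := by
    rw [← mul_inv]
    rw [← Complex.ofReal_mul, Real.mul_self_sqrt N.cast_nonneg, Complex.ofReal_natCast]
  rw [uniformPure, InnerProductSpace.rankOne_apply, inner_smul_right, inner_uniformState,
    ← inner_conj_symm, inner_uniformState]
  by_cases h1 : n < N <;> by_cases h2 : m < N <;> simp [h1, h2, ← h]

theorem isDensityOperator_uniformPure (b : HilbertBasis ℕ ℂ H) {N : ℕ} (hN : N ≠ 0) :
    IsDensityOperator b (uniformPure b N) :=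
  isDensityOperator_rankOne b (norm_uniformState b hN)

variable [CompleteSpace H]

/-- Mixtures with the nonnegative weights `k + g` and `k - g` are positive. -/
theorem IsDensityOperator.abs_re_inner_twirl_le {b : HilbertBasis ℕ ℂ H} {ρ : H →L[ℂ] H}
    (hρ : IsDensityOperator b ρ) {μ : Measure ℝ} {g k : ℝ → ℝ} (hg : Integrable g μ)
    (hk : Integrable k μ) (hgk : ∀ θ, |g θ| ≤ k θ) (x : H) :
    |(⟪x, twirl b μ g ρ x⟫_ℂ).re| ≤ (⟪x, twirl b μ k ρ x⟫_ℂ).re := by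
  have add := (hρ.isPositive_twirl (hk.add hg) fun θ => by
    have := (abs_le.1 (hgk θ)).1; simp only [Pi.add_apply]; linarith).re_inner_nonneg_right x
  have sub := (hρ.isPositive_twirl (hk.sub hg) fun θ => by
    have := (abs_le.1 (hgk θ)).2; simp only [Pi.sub_apply]; linarith).re_inner_nonneg_right x
  have e1 : twirl b μ (k + g) ρ = twirl b μ k ρ + twirl b μ g ρ := by
    rw [twirl, twirl, twirl,
      ← integral_add (hρ.integrable_smul_rotate hk) (hρ.integrable_smul_rotate hg)]
    simp only [Pi.add_apply, Complex.ofReal_add, add_smul]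
  have e2 : twirl b μ (k - g) ρ = twirl b μ k ρ - twirl b μ g ρ := by
    rw [twirl, twirl, twirl,
      ← integral_sub (hρ.integrable_smul_rotate hk) (hρ.integrable_smul_rotate hg)]
    simp only [Pi.sub_apply, Complex.ofReal_sub, sub_smul]
  rw [e1, add_apply, inner_add_right] at add
  rw [e2, sub_apply, inner_sub_right] at sub
  change 0 ≤ (_ + _ : ℂ).re at add
  change 0 ≤ (_ - _ : ℂ).re at sub
  rw [Complex.add_re] at add
  rw [Complex.sub_re] at sub
  rw [abs_le]
  constructor <;> linarith

/-- The Toeplitz operator with symbol `s`, truncated to the span of `|0⟩, …, |N-1⟩`. -/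
def truncatedToeplitz (b : HilbertBasis ℕ ℂ H) (s : ℝ → ℝ) (N : ℕ) : H →L[ℂ] H :=
  twirl b periodMeasure (fun θ => N / (2 * Real.pi) * s θ) (uniformPure b N)

section toeplitz

variable (b : HilbertBasis ℕ ℂ H) {s : ℝ → ℝ} (hs : Integrable s periodMeasure) {N : ℕ}
  (hN : N ≠ 0)
include hs hN

theorem isSelfAdjoint_truncatedToeplitz : IsSelfAdjoint (truncatedToeplitz b s N) :=
  (isDensityOperator_uniformPure b hN).isSelfAdjoint_twirl (hs.const_mul _)

/-- The weight `N` cancels the entries `1/N` of `uniformPure`, leaving the Fourier coefficients of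
the symbol. The realisation as a mixture makes positivity arguments available for the norm bound. -/
theorem inner_truncatedToeplitz_fock (n m : ℕ) :
    ⟪b n, truncatedToeplitz b s N (b m)⟫_ℂ = if n < N ∧ m < N then
      1 / (2 * Real.pi) * ∫ θ, (s θ : ℂ) * Complex.exp (((m - n : ℤ) : ℂ) * θ * Complex.I)
        ∂periodMeasure else 0 := by
  have hN' : (N : ℂ) ≠ 0 := by exact_mod_cast hN
  rw [truncatedToeplitz, (isDensityOperator_uniformPure b hN).inner_twirl_fock (hs.const_mul _),
    inner_uniformPure]
  split_ifs
  · simp only [Complex.ofReal_mul, mul_assoc]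
    rw [integral_const_mul]
    generalize ∫ θ, (s θ : ℂ) * Complex.exp (((m - n : ℤ) : ℂ) * ((θ : ℂ) * Complex.I))
      ∂periodMeasure = I
    push_cast
    field_simp
  · rw [mul_zero]

omit hs in
-- The symbol 1 gives the orthogonal projection onto the first `N` Fock states. Symbols bounded by 1
-- are compared with it.
theorem inner_truncatedToeplitz_one_le (x : H) :
    (⟪x, truncatedToeplitz b (fun _ => 1) N x⟫_ℂ).re ≤ ‖x‖ ^ 2 := by
  have h1 : Integrable (fun _ : ℝ => (1 : ℝ)) periodMeasure :=
    integrable_periodMeasure continuous_const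
  have e : truncatedToeplitz b (fun _ => 1) N
      = ∑ n ∈ Finset.range N, InnerProductSpace.rankOne ℂ (b n) (b n) := by
    classical
    refine ext_matrix b fun n m => ?_
    have hπ : (Real.pi : ℂ) ≠ 0 := by exact_mod_cast Real.pi_pos.ne'
    rw [inner_truncatedToeplitz_fock b h1 hN]
    simp only [Complex.ofReal_one, one_mul, setIntegral_exp_int_mul, sum_apply, inner_sum,
      InnerProductSpace.rankOne_apply, inner_smul_right,
      orthonormal_iff_ite.1 b.orthonormal, mul_ite, mul_one, mul_zero, Finset.sum_ite_eq,
      Finset.mem_range, sub_eq_zero, Nat.cast_inj]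
    rcases eq_or_ne m n with rfl | hnm
    · by_cases hm : m < N <;> simp [hm, field]
    · simp [hnm, hnm.symm]
  have h := sum_le_hasSum (Finset.range N) (fun _ _ => sq_nonneg _) (hasSum_norm_inner_sq b x)
  refine le_trans (le_of_eq ?_) h
  rw [e, sum_apply, inner_sum, Complex.re_sum]
  refine Finset.sum_congr rfl fun n _ => ?_
  rw [InnerProductSpace.rankOne_apply, inner_smul_right]
  have := inner_mul_symm_re_eq_norm (𝕜 := ℂ) (b n) x
  rw [norm_mul, norm_inner_symm x, ← sq] at this
  exact this

theorem abs_re_inner_truncatedToeplitz_le (h1 : ∀ θ, |s θ| ≤ 1) (x : H) :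
    |(⟪x, truncatedToeplitz b s N x⟫_ℂ).re| ≤ ‖x‖ ^ 2 := by
  refine le_trans ?_ (inner_truncatedToeplitz_one_le b hN x)
  refine (isDensityOperator_uniformPure b hN).abs_re_inner_twirl_le (hs.const_mul _)
    (integrable_periodMeasure continuous_const) (fun θ => ?_) x
  rw [abs_mul, abs_of_nonneg (by positivity)]
  gcongr
  exact h1 θ

theorem isBinaryPOVM_truncatedToeplitz (h1 : ∀ θ, |s θ| ≤ 1) :
    IsBinaryPOVM ((1 / 2 : ℂ) • (1 + truncatedToeplitz b s N))
      ((1 / 2 : ℂ) • (1 - truncatedToeplitz b s N)) := by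
  open ComplexOrder in
  have half : (0 : ℂ) ≤ 1 / 2 := by
    rw [show (1 / 2 : ℂ) = ((1 / 2 : ℝ) : ℂ) by norm_num]
    exact RCLike.ofReal_nonneg.2 one_half_pos.le
  have sa := isSelfAdjoint_truncatedToeplitz b hs hN
  have hx : ∀ x : H, (⟪x, x⟫_ℂ).re = ‖x‖ ^ 2 := fun x => inner_self_eq_norm_sq (𝕜 := ℂ) x
  have bd := fun x => abs_le.1 (abs_re_inner_truncatedToeplitz_le b hs hN h1 x)
  refine ⟨ContinuousLinearMap.IsPositive.smul_of_nonneg ?_ half,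
    ContinuousLinearMap.IsPositive.smul_of_nonneg ?_ half, ?_⟩
  · refine ContinuousLinearMap.isPositive_def'.2 ⟨(IsSelfAdjoint.one _).add sa, fun x => ?_⟩
    rw [ContinuousLinearMap.reApplyInnerSelf, inner_re_symm, add_apply, one_apply_eq_self,
      inner_add_right]
    change 0 ≤ (_ + _ : ℂ).re
    rw [Complex.add_re, hx]
    linarith [(bd x).1]
  · refine ContinuousLinearMap.isPositive_def'.2 ⟨(IsSelfAdjoint.one _).sub sa, fun x => ?_⟩
    rw [ContinuousLinearMap.reApplyInnerSelf, inner_re_symm, sub_apply, one_apply_eq_self,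
      inner_sub_right]
    change 0 ≤ (_ - _ : ℂ).re
    rw [Complex.sub_re, hx]
    linarith [(bd x).2]
  · rw [← smul_add, add_add_sub_cancel, ← two_smul ℂ (1 : H →L[ℂ] H), smul_smul]
    norm_num

/-- Both matrices live on the `N × N` block, so all sums are finite. The second factor enters
transposed, hence `c` at `-(m - n)`. -/
theorem trace_truncatedToeplitz_mul {A : H →L[ℂ] H} {c : ℤ → ℂ}
    (hA : ∀ n m : ℕ, ⟪b n, A (b m)⟫_ℂ = c (m - n) * ⟪b n, uniformPure b N (b m)⟫_ℂ) :
    trace b (truncatedToeplitz b s N * A)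
      = (N : ℝ)⁻¹ • ∑ n ∈ Finset.range N, ∑ m ∈ Finset.range N,
        c (-(m - n)) * (1 / (2 * Real.pi) * ∫ θ, (s θ : ℂ)
          * Complex.exp (((m - n : ℤ) : ℂ) * θ * Complex.I) ∂periodMeasure) := by
  have e : ∀ n, ⟪b n, (truncatedToeplitz b s N * A) (b n)⟫_ℂ
      = ∑ m ∈ Finset.range N, ⟪b n, truncatedToeplitz b s N (b m)⟫_ℂ * ⟪b m, A (b n)⟫_ℂ :=
    fun n => by
    have h := b.hasSum_inner_mul_inner (star (truncatedToeplitz b s N) (b n)) (A (b n))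
    simp only [ContinuousLinearMap.star_eq_adjoint, ContinuousLinearMap.adjoint_inner_left] at h
    refine h.unique (hasSum_sum_of_ne_finset_zero fun m hm => ?_)
    rw [inner_truncatedToeplitz_fock b hs hN, if_neg (by simp at hm; omega), zero_mul]
  rw [trace, tsum_eq_sum (s := Finset.range N), Finset.smul_sum]
  · refine Finset.sum_congr rfl fun n hn => ?_
    rw [e, Finset.smul_sum]
    refine Finset.sum_congr rfl fun m hm => ?_
    rw [Finset.mem_range] at hn hm
    rw [inner_truncatedToeplitz_fock b hs hN, if_pos ⟨hn, hm⟩, hA, inner_uniformPure,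
      if_pos ⟨hm, hn⟩, neg_sub, Complex.real_smul]
    push_cast
    ring
  · intro n hn
    rw [e]
    refine Finset.sum_eq_zero fun m _ => ?_
    rw [inner_truncatedToeplitz_fock b hs hN, if_neg (by simp at hn; omega), zero_mul]

end toeplitz

/-- The Jordan decomposition gives $A=A^+-A^-$ and $|A|=A^++A^-$, and the positive case applies to
each part. -/
theorem enorm_trace_mul_le_traceNorm (b : HilbertBasis ℕ ℂ H) {A : H →L[ℂ] H}
    (hA : IsSelfAdjoint A) {T : H →L[ℂ] H} (hT : ‖T‖ ≤ 1) :
    ‖trace b (T * A)‖ₑ ≤ traceNorm b A := by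
  have hp := (ContinuousLinearMap.nonneg_iff_isPositive (A⁺)).1 (CFC.posPart_nonneg A)
  have hm := (ContinuousLinearMap.nonneg_iff_isPositive (A⁻)).1 (CFC.negPart_nonneg A)
  have e1 : A = A⁺ - A⁻ := (CFC.posPart_sub_negPart A hA).symm
  have e2 : CFC.sqrt (star A * A) = A⁺ + A⁻ := (CFC.posPart_add_negPart A hA).symm
  have e3 : traceNorm b A = traceENN b A⁺ + traceENN b A⁻ := by
    rw [traceNorm, e2, traceENN, traceENN, ← ENNReal.tsum_add]
    refine tsum_congr fun n => ?_
    rw [add_apply, inner_add_right, Complex.add_re]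
    exact ENNReal.ofReal_add (hp.re_inner_nonneg_right _) (hm.re_inner_nonneg_right _)
  rw [e3]
  refine (enorm_tsum_le_tsum_enorm).trans ?_
  refine le_trans ?_ (add_le_add (tsum_enorm_inner_mul_le b hp hT)
    (tsum_enorm_inner_mul_le b hm hT))
  rw [← ENNReal.tsum_add]
  refine ENNReal.tsum_le_tsum fun n => ?_
  conv_lhs => rw [e1]
  rw [mul_sub, sub_apply, inner_sub_right]
  exact enorm_sub_le

theorem measurable_sign_of_measurable {f : ℝ → ℝ} (hf : Measurable f) :
    Measurable fun θ => if 0 ≤ f θ then (1 : ℝ) else -1 :=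
  Measurable.ite (measurableSet_le measurable_const hf) measurable_const measurable_const

theorem exists_tendsto_trace (b : HilbertBasis ℕ ℂ H) {γ₁ γ₂ : ℝ≥0} (hγ₁ : 0 < γ₁) (hγ₂ : 0 < γ₂)
    (q₁ q₂ : ℝ) : ∃ s : ℝ → ℝ, Integrable s periodMeasure ∧ (∀ θ, |s θ| ≤ 1) ∧
      Tendsto (fun N : ℕ => (trace b (truncatedToeplitz b s N
        * discrepancy b γ₁ γ₂ q₁ q₂ (uniformPure b N))).re) atTop
        (𝓝 (∫ θ, |densityDiff γ₁ γ₂ q₁ q₂ θ| ∂periodMeasure)) := by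
  set f := densityDiff γ₁ γ₂ q₁ q₂ with hf
  have hfc : Continuous f := continuous_densityDiff hγ₁ hγ₂ q₁ q₂
  set s : ℝ → ℝ := fun θ => if 0 ≤ f θ then (1 : ℝ) else -1 with hs
  have hs1 : ∀ θ, |s θ| ≤ 1 := fun θ => by
    simp only [hs]; split_ifs <;> simp
  have hsf : ∀ θ, s θ * f θ = |f θ| := fun θ => by
    simp only [hs]
    split_ifs with h
    · rw [one_mul, abs_of_nonneg h]
    · rw [abs_of_neg (not_le.1 h), neg_one_mul]
  have hsi : Integrable s periodMeasure :=
    (integrable_periodMeasure (continuous_const (y := (1 : ℝ)))).mono'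
      (measurable_sign_of_measurable hfc.measurable).aestronglyMeasurable
      (Eventually.of_forall hs1)
  refine ⟨s, hsi, hs1, ?_⟩
  set c : ℤ → ℂ := fun k => q₁ * gaussCoeff γ₁ k - q₂ * gaussCoeff γ₂ k with hc
  have hc_neg : ∀ k, c (-k) = c k := fun k => by simp only [hc, gaussCoeff_neg]
  have hsc : Integrable (fun θ => (s θ : ℂ)) periodMeasure := hsi.ofReal
  have hw : ∀ {γ : ℝ≥0}, 0 < γ →
      Integrable (fun θ => (s θ : ℂ) * wrappedNormal γ θ) periodMeasure := fun {γ} hγ => by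
    have h1 : Integrable (fun θ => ((wrappedNormal γ θ : ℝ) : ℂ)) periodMeasure :=
      (integrable_periodMeasure (continuous_wrappedNormal hγ)).ofReal
    exact h1.bdd_mul (c := 1) hsc.aestronglyMeasurable (Eventually.of_forall fun θ => by
      rw [Complex.norm_real]; exact hs1 θ)
  have key := tendsto_toeplitz_mean (((hasSum_integral_mul_wrappedNormal hγ₁ hsc).mul_left
    (q₁ : ℂ)).sub ((hasSum_integral_mul_wrappedNormal hγ₂ hsc).mul_left (q₂ : ℂ)))
  have lim : (q₁ : ℂ) * ∫ θ, (s θ : ℂ) * wrappedNormal γ₁ θ ∂periodMeasure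
      - (q₂ : ℂ) * ∫ θ, (s θ : ℂ) * wrappedNormal γ₂ θ ∂periodMeasure
      = ((∫ θ, |f θ| ∂periodMeasure : ℝ) : ℂ) := by
    rw [← integral_const_mul, ← integral_const_mul,
      ← integral_sub ((hw hγ₁).const_mul _) ((hw hγ₂).const_mul _), ← integral_complex_ofReal]
    refine integral_congr_ae (Eventually.of_forall fun θ => ?_)
    change _ = ((|f θ| : ℝ) : ℂ)
    rw [← hsf, hf, densityDiff]
    push_cast
    ring
  rw [lim] at key
  have key2 := (Complex.continuous_re.tendsto _).comp key
  rw [Complex.ofReal_re] at key2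
  -- For `N = 0` the superposition is the zero vector, so the identity is needed only eventually.
  refine key2.congr' ?_
  filter_upwards [eventually_ne_atTop 0] with N hN
  have hA : ∀ n m : ℕ, ⟪b n, discrepancy b γ₁ γ₂ q₁ q₂ (uniformPure b N) (b m)⟫_ℂ
      = c (m - n) * ⟪b n, uniformPure b N (b m)⟫_ℂ := fun n m => by
    rw [(isDensityOperator_uniformPure b hN).discrepancy_eq_twirl hγ₁ hγ₂,
      (isDensityOperator_uniformPure b hN).inner_twirl_densityDiff_fock hγ₁ hγ₂]
  rw [trace_truncatedToeplitz_mul b hsi hN hA, Function.comp_apply]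
  congr 2
  refine Finset.sum_congr rfl fun n _ => Finset.sum_congr rfl fun m _ => ?_
  -- Evenness of the Gaussian coefficients undoes the transposition.
  rw [hc_neg]
  simp only [hc]
  ring

end

end BosonicDephasing

end

/-! ### Assembly of the bounds -/

theorem theorem2 {H : Type*} [NormedAddCommGroup H] [InnerProductSpace ℂ H] [CompleteSpace H]
    (b : HilbertBasis ℕ ℂ H) (γ₁ γ₂ : ℝ≥0) (hγ₁ : 0 < γ₁) (hγ₂ : 0 < γ₂)
    (q₁ q₂ : ℝ) (hq₁ : 0 ≤ q₁) (hq₂ : 0 ≤ q₂) (hq : q₁ + q₂ = 1) :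
    IntervalIntegrable (fun θ => q₁ * BosonicDephasing.wrappedNormal γ₁ θ
        - q₂ * BosonicDephasing.wrappedNormal γ₂ θ) MeasureTheory.volume (-Real.pi) Real.pi ∧
    IsLUB {t : ℝ≥0∞ | ∃ ρ : H →L[ℂ] H, BosonicDephasing.IsPureState ρ ∧
        t = BosonicDephasing.traceNorm b (BosonicDephasing.discrepancy b γ₁ γ₂ q₁ q₂ ρ)}
      (ENNReal.ofReal (∫ θ in (-Real.pi)..Real.pi,
        |q₁ * BosonicDephasing.wrappedNormal γ₁ θ - q₂ * BosonicDephasing.wrappedNormal γ₂ θ|)) ∧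
    IsGLB {e : ℝ | ∃ ρ P₁ P₂ : H →L[ℂ] H, BosonicDephasing.IsDensityOperator b ρ ∧
        BosonicDephasing.IsBinaryPOVM P₁ P₂ ∧
        e = BosonicDephasing.errorProbability b γ₁ γ₂ q₁ q₂ ρ P₁ P₂}
      ((1 - ∫ θ in (-Real.pi)..Real.pi,
        |q₁ * BosonicDephasing.wrappedNormal γ₁ θ
          - q₂ * BosonicDephasing.wrappedNormal γ₂ θ|) / 2) := by
  have hc := BosonicDephasing.continuous_densityDiff hγ₁ hγ₂ q₁ q₂
  have hi := BosonicDephasing.integrable_periodMeasure hc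
  have hL : ∫ θ in (-Real.pi)..Real.pi,
      |q₁ * BosonicDephasing.wrappedNormal γ₁ θ - q₂ * BosonicDephasing.wrappedNormal γ₂ θ|
      = ∫ θ, |BosonicDephasing.densityDiff γ₁ γ₂ q₁ q₂ θ| ∂BosonicDephasing.periodMeasure :=
    intervalIntegral.integral_of_le (by linarith [Real.pi_pos])
  obtain ⟨s, hs, hs1, lim⟩ := BosonicDephasing.exists_tendsto_trace b hγ₁ hγ₂ q₁ q₂
  rw [hL]
  refine ⟨hc.intervalIntegrable _ _, ⟨?_, fun u hu => ?_⟩, ⟨?_, fun u hu => ?_⟩⟩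
  · rintro _ ⟨_, ⟨ψ, hψ, rfl⟩, rfl⟩
    have hρ := BosonicDephasing.isDensityOperator_rankOne b hψ
    rw [hρ.discrepancy_eq_twirl hγ₁ hγ₂]
    exact hρ.traceNorm_twirl_le hi
  -- Each Toeplitz test bounds the trace norm from below at a uniform superposition; any upper bound
  -- therefore dominates the limit.
  · refine le_of_tendsto ((ENNReal.continuous_ofReal.tendsto _).comp lim) ?_
    filter_upwards [Filter.eventually_ne_atTop 0] with N hN
    have hρ := BosonicDephasing.isDensityOperator_uniformPure b hN
    refine le_trans ?_ (hu ⟨_, ⟨_, BosonicDephasing.norm_uniformState b hN, rfl⟩, rfl⟩)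
    have hT := BosonicDephasing.norm_le_one_of_abs_re_inner_le
      (BosonicDephasing.isSelfAdjoint_truncatedToeplitz b hs hN)
      (BosonicDephasing.abs_re_inner_truncatedToeplitz_le b hs hN hs1)
    have sa : IsSelfAdjoint (BosonicDephasing.discrepancy b γ₁ γ₂ q₁ q₂
        (BosonicDephasing.uniformPure b N)) := by
      rw [hρ.discrepancy_eq_twirl hγ₁ hγ₂]
      exact hρ.isSelfAdjoint_twirl hi
    refine le_trans ?_ (BosonicDephasing.enorm_trace_mul_le_traceNorm b sa hT)
    rw [← ofReal_norm]
    exact ENNReal.ofReal_le_ofReal (Complex.re_le_norm _)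
  · rintro _ ⟨ρ, P₁, P₂, hρ, hP, rfl⟩
    rw [hρ.errorProbability_eq γ₁ γ₂ hq hP, hρ.discrepancy_eq_twirl hγ₁ hγ₂]
    linarith [(Complex.re_le_norm _).trans (hρ.norm_trace_mul_twirl_le hi hP.norm_sub_le)]
  -- The measurements $(1\pm T_N)/2$ built from the same tests have error probabilities tending to
  -- the claimed infimum.
  · refine ge_of_tendsto ((lim.const_sub 1).div_const 2) ?_
    filter_upwards [Filter.eventually_ne_atTop 0] with N hN
    have hρ := BosonicDephasing.isDensityOperator_uniformPure b hN
    have hP := BosonicDephasing.isBinaryPOVM_truncatedToeplitz b hs hN hs1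
    refine (hu ⟨_, _, _, hρ, hP, rfl⟩).trans_eq ?_
    rw [hρ.errorProbability_eq γ₁ γ₂ hq hP]
    congr 5
    rw [← smul_sub, add_sub_sub_cancel, ← two_smul ℂ, smul_smul]
    norm_num
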